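/- Let $M$ be a smooth (finite-dimensional, Hausdorff) manifold and let $\Omega^1(M)$ be the space of smooth 1-forms. A contravariant 2-tensor $P$ on $M$ is viewed as a smooth bundle morphism $P:T^*M\to TM$, with $\langle P,\alpha\wedge\beta\rangle=\langle\beta,P(\alpha)\rangle$; it is a Poisson tensor if it is skew-symmetric and $\{f,g\}^P=\langle P,df\wedge dg\rangle$ satisfies the Jacobi identity. For such a morphism $P$ put $$\mu^P(\alpha,\beta)=\mathcal L_{P(\alpha)}\beta-\mathcal L_{P(\beta)}\alpha-d\langle P,\alpha\wedge\beta\rangle,\qquad \alpha,\beta\in\Omega^1(M).$$ Let $N:T^*M\to T^*M$ be a smooth bundle morphism over $\mathrm{id}_M$, let ${}^tN:TM\to TM$ be its dual, let $E^1_x=N_x^{\dim M}(T^*_xM)$ be the component of the Riesz decomposition of $T^*_xM$ on which $N_x$ is invertible, and let $\mathcal A^1$ be the space of smooth 1-forms with values in $E^1$. For a bilinear product $\mu$ on $\Omega^1(M)$, $N$ is called a Saletan tensor for $\mu$ if the Nijenhuis torsion $$T_N\mu(\alpha,\beta)=\mu(N\alpha,N\beta)-N\big(\mu(N\alpha,\beta)+\mu(\alpha,N\beta)-N\mu(\alpha,\beta)\big)$$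 lies in $N(\mathcal A^1)$ for all $\alpha,\beta\in\Omega^1(M)$. The contraction $\mu_N$ of $\mu$ by $N$ is the product on $\Omega^1(M)$ given by the pointwise limit $$\mu_N(\alpha,\beta)=\lim_{\lambda\to0,\ \lambda\ne0}U(\lambda)^{-1}\mu\big(U(\lambda)\alpha,U(\lambda)\beta\big),\qquad U(\lambda)=\lambda I+N.$$ Theorem. Let $P$ be a Poisson tensor on $M$ and let $N$ be a Saletan tensor for $\mu^P$. Then the contraction $\mu^P_N$ exists, as a product on $\Omega^1(M)$, and there is a Poisson tensor $P_1$ on $M$ with $\mu^P_N=\mu^{P_1}$ if and only if (i) $PN={}^tN\,P$, and (ii) $\mu^P_N=\mu^{PN}$. Moreover, if $P_1$ is a Poisson tensor with $\mu^P_N=\mu^{P_1}$, then $P_1=PN$. -/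

import Mathlib

open Bundle Filter Topology
open scoped Manifold ContDiff Bundle

noncomputable section

namespace PoissonContraction

/-- The cotangent space `T*ₓM`. -/
abbrev CotangentFiber (E : Type*) [NormedAddCommGroup E] [NormedSpace ℝ E]
    {M : Type*} [TopologicalSpace M] [ChartedSpace E M] (x : M) : Type _ :=
  TangentSpace 𝓘(ℝ, E) x →L[ℝ] ℝ

section Bundles

variable (E : Type*) [NormedAddCommGroup E] [NormedSpace ℝ E]
  (M : Type*) [TopologicalSpace M] [ChartedSpace E M] [IsManifold 𝓘(ℝ, E) ∞ M]

/-- Smooth vector fields on `M`. -/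
abbrev VectorFields : Type _ :=
  Cₛ^∞⟮𝓘(ℝ, E); E, (TangentSpace 𝓘(ℝ, E) : M → Type _)⟯

/-- Smooth 1-forms on `M`, i.e. smooth sections of `T*M`. -/
abbrev OneForms : Type _ :=
  Cₛ^∞⟮𝓘(ℝ, E); E →L[ℝ] ℝ, fun x : M => CotangentFiber E x⟯

/-- Smooth vector bundle morphisms `T*M → TM` over the identity, as smooth sections of
`Hom(T*M, TM)`. A contravariant 2-tensor `P` is viewed as such a morphism. -/
abbrev ContravariantTensors : Type _ :=
  Cₛ^∞⟮𝓘(ℝ, E); (E →L[ℝ] ℝ) →L[ℝ] E,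
    fun x : M => CotangentFiber E x →L[ℝ] TangentSpace 𝓘(ℝ, E) x⟯

/-- Smooth vector bundle morphisms `T*M → T*M` over the identity, as smooth sections of
`Hom(T*M, T*M)`. -/
abbrev CotangentEndomorphisms : Type _ :=
  Cₛ^∞⟮𝓘(ℝ, E); (E →L[ℝ] ℝ) →L[ℝ] (E →L[ℝ] ℝ),
    fun x : M => CotangentFiber E x →L[ℝ] CotangentFiber E x⟯

end Bundles

variable {E : Type*} [NormedAddCommGroup E] [NormedSpace ℝ E]
  {M : Type*} [TopologicalSpace M] [ChartedSpace E M] [IsManifold 𝓘(ℝ, E) ∞ M]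

/-! ### Smoothness facts used by the definitions -/

theorem contMDiffAt_oneForm_apply {φ : ∀ x : M, CotangentFiber E x}
    {Y : ∀ x : M, TangentSpace 𝓘(ℝ, E) x} {x₀ : M}
    (hφ : ContMDiffAt 𝓘(ℝ, E) (𝓘(ℝ, E).prod 𝓘(ℝ, E →L[ℝ] ℝ)) ∞
      (fun x => TotalSpace.mk' (E →L[ℝ] ℝ) (E := fun x : M => CotangentFiber E x) x (φ x)) x₀)
    (hY : ContMDiffAt 𝓘(ℝ, E) (𝓘(ℝ, E).prod 𝓘(ℝ, E)) ∞
      (fun x => TotalSpace.mk' E x (Y x)) x₀) :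
    ContMDiffAt 𝓘(ℝ, E) 𝓘(ℝ, ℝ) ∞ (fun x => φ x (Y x)) x₀ := by
  have := hφ.clm_bundle_apply hY
  rw [contMDiffAt_section] at this
  exact this

theorem contMDiffAt_oneForm_of_apply [FiniteDimensional ℝ E]
    {φ : ∀ x : M, CotangentFiber E x} {x₀ : M}
    (h : ∀ Y : ∀ x : M, TangentSpace 𝓘(ℝ, E) x,
      ContMDiffAt 𝓘(ℝ, E) (𝓘(ℝ, E).prod 𝓘(ℝ, E)) ∞ (fun x => TotalSpace.mk' E x (Y x)) x₀ →
        ContMDiffAt 𝓘(ℝ, E) 𝓘(ℝ, ℝ) ∞ (fun x => φ x (Y x)) x₀) :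
    ContMDiffAt 𝓘(ℝ, E) (𝓘(ℝ, E).prod 𝓘(ℝ, E →L[ℝ] ℝ)) ∞
      (fun x => TotalSpace.mk' (E →L[ℝ] ℝ) (E := fun x : M => CotangentFiber E x) x (φ x)) x₀ := by
  rw [contMDiffAt_hom_bundle]
  refine ⟨contMDiffAt_id, ?_⟩
  let b := Module.finBasis ℝ E
  let t := trivializationAt E (TangentSpace 𝓘(ℝ, E) : M → Type _) x₀
  have hx : x₀ ∈ t.baseSet := FiberBundle.mem_baseSet_trivializationAt' x₀
  let L : (Fin (Module.finrank ℝ E) → ℝ) →L[ℝ] (E →L[ℝ] ℝ) :=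
    LinearMap.toContinuousLinearMap
      { toFun := fun c => ∑ i, c i • (b.coord i).toContinuousLinearMap
        map_add' := fun c d => by simp [add_smul, Finset.sum_add_distrib]
        map_smul' := fun r c => by simp [mul_smul, Finset.smul_sum] }
  have key : ContMDiffAt 𝓘(ℝ, E) 𝓘(ℝ, Fin (Module.finrank ℝ E) → ℝ) ∞
      (fun x => fun i => φ x (t.localFrame b i x)) x₀ :=
    contMDiffAt_pi_space.2 fun i => h _ (contMDiffAt_localFrame_of_mem ∞ _ b i hx)
  refine ((L.contMDiff.contMDiffAt (n := ∞)).comp x₀ key).congr_of_eventuallyEq ?_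
  filter_upwards [t.open_baseSet.mem_nhds hx] with x hxt
  ext v
  conv_lhs => rw [← b.sum_repr v]
  conv_rhs => rw [← b.sum_repr v]
  simp only [map_sum, map_smul]
  refine Finset.sum_congr rfl fun i _ => ?_
  congr 1
  have h1 : t.localFrame b i x = t.symm x (b i) := by
    rw [t.localFrame_apply_of_mem_baseSet b hxt]
    simp [Trivialization.basisAt]
  have h2 : L (fun i => φ x (t.localFrame b i x)) (b i) = φ x (t.localFrame b i x) := by
    simp only [L, LinearMap.coe_toContinuousLinearMap', LinearMap.coe_mk, AddHom.coe_mk,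
      sum_apply, smul_apply, Module.Basis.coord_apply,
      Module.Basis.repr_self, smul_eq_mul]
    rw [Finset.sum_eq_single i]
    · simp
    · intro j _ hj
      simp [hj.symm]
    · simp
  change _ = L (fun i => φ x (t.localFrame b i x)) (b i)
  rw [h2, h1]
  simp only [t] at hxt
  simp only [ContinuousLinearMap.inCoordinates, ContinuousLinearMap.comp_apply, t]
  erw [Trivialization.symmL_apply _ hxt]
  simp

theorem contMDiffAt_mvfderiv {f : M → ℝ} {x₀ : M}
    (hf : ContMDiffAt 𝓘(ℝ, E) 𝓘(ℝ, ℝ) ∞ f x₀) :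
    ContMDiffAt 𝓘(ℝ, E) (𝓘(ℝ, E).prod 𝓘(ℝ, E →L[ℝ] ℝ)) ∞
      (fun x => TotalSpace.mk' (E →L[ℝ] ℝ) (E := fun x : M => CotangentFiber E x) x
        (mvfderiv 𝓘(ℝ, E) f x)) x₀ := by
  rw [contMDiffAt_hom_bundle]
  refine ⟨contMDiffAt_id, ?_⟩
  have := hf.mfderiv_const (m := ∞) (by simp)
  refine this.congr_of_eventuallyEq (Eventually.of_forall fun x => ?_)
  ext v
  simp [inTangentCoordinates, ContinuousLinearMap.inCoordinates, mvfderiv]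
  rfl

theorem contMDiffAt_comp {P : ∀ x : M, CotangentFiber E x →L[ℝ] TangentSpace 𝓘(ℝ, E) x}
    {N : ∀ x : M, CotangentFiber E x →L[ℝ] CotangentFiber E x} {x₀ : M}
    (hP : ContMDiffAt 𝓘(ℝ, E) (𝓘(ℝ, E).prod 𝓘(ℝ, (E →L[ℝ] ℝ) →L[ℝ] E)) ∞
      (fun x => TotalSpace.mk' ((E →L[ℝ] ℝ) →L[ℝ] E)
        (E := fun x : M => CotangentFiber E x →L[ℝ] TangentSpace 𝓘(ℝ, E) x) x (P x)) x₀)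
    (hN : ContMDiffAt 𝓘(ℝ, E) (𝓘(ℝ, E).prod 𝓘(ℝ, (E →L[ℝ] ℝ) →L[ℝ] (E →L[ℝ] ℝ))) ∞
      (fun x => TotalSpace.mk' ((E →L[ℝ] ℝ) →L[ℝ] (E →L[ℝ] ℝ))
        (E := fun x : M => CotangentFiber E x →L[ℝ] CotangentFiber E x) x (N x)) x₀) :
    ContMDiffAt 𝓘(ℝ, E) (𝓘(ℝ, E).prod 𝓘(ℝ, (E →L[ℝ] ℝ) →L[ℝ] E)) ∞
      (fun x => TotalSpace.mk' ((E →L[ℝ] ℝ) →L[ℝ] E)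
        (E := fun x : M => CotangentFiber E x →L[ℝ] TangentSpace 𝓘(ℝ, E) x) x
        ((P x).comp (N x))) x₀ := by
  rw [contMDiffAt_hom_bundle] at hP hN ⊢
  refine ⟨contMDiffAt_id, ?_⟩
  refine (hP.2.clm_comp hN.2).congr_of_eventuallyEq ?_
  let t := trivializationAt (E →L[ℝ] ℝ) (fun x : M => CotangentFiber E x) x₀
  have hx : x₀ ∈ t.baseSet := FiberBundle.mem_baseSet_trivializationAt' x₀
  filter_upwards [t.open_baseSet.mem_nhds hx] with x hxt
  ext v
  simp only [ContinuousLinearMap.inCoordinates, ContinuousLinearMap.comp_apply]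
  rw [Trivialization.symmL_continuousLinearMapAt _ hxt]

/-! ### Cartan calculus for 1-forms -/

/-- The smooth function `⟨α, X⟩`. -/
def applyOneForm (α : OneForms E M) (X : VectorFields E M) : C^∞⟮𝓘(ℝ, E), M; ℝ⟯ :=
  ⟨fun x => α x (X x), fun x => contMDiffAt_oneForm_apply (α.contMDiff x) (X.contMDiff x)⟩

/-- The differential of a smooth function, as a smooth 1-form. -/
def differential (f : C^∞⟮𝓘(ℝ, E), M; ℝ⟯) : OneForms E M :=
  ⟨fun x => mvfderiv 𝓘(ℝ, E) f x, fun x => contMDiffAt_mvfderiv (f.contMDiff x)⟩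

theorem tensorialAt_lieDerivative [FiniteDimensional ℝ E] (X : VectorFields E M)
    (β : OneForms E M) (x : M) :
    TensorialAt 𝓘(ℝ, E) E (fun Y : ∀ y : M, TangentSpace 𝓘(ℝ, E) y =>
      mvfderiv 𝓘(ℝ, E) (fun y => β y (Y y)) x (X x)
        - β x (VectorField.mlieBracket 𝓘(ℝ, E) X Y x)) x where
  smul {f σ} hf hσ := by
    have h1 : MDifferentiableAt 𝓘(ℝ, E) 𝓘(ℝ, ℝ) (fun y => β y (σ y)) x := by
      have := (β.mdifferentiableAt (x := x)).clm_bundle_apply hσ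
      rw [mdifferentiableAt_section] at this
      exact this
    have h2 : (fun y => β y ((f • σ) y)) = f * (fun y => β y (σ y)) := by
      ext y; simp
    have : IsManifold 𝓘(ℝ, E) (minSmoothness ℝ 2) M := by
      simp; infer_instance
    rw [h2, mvfderiv_mul hf h1, VectorField.mlieBracket_smul_right hf hσ]
    simp
    ring
  add {σ τ} hσ hτ := by
    have h1 : MDifferentiableAt 𝓘(ℝ, E) 𝓘(ℝ, ℝ) (fun y => β y (σ y)) x := by
      have := (β.mdifferentiableAt (x := x)).clm_bundle_apply hσ
      rw [mdifferentiableAt_section] at this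
      exact this
    have h2 : MDifferentiableAt 𝓘(ℝ, E) 𝓘(ℝ, ℝ) (fun y => β y (τ y)) x := by
      have := (β.mdifferentiableAt (x := x)).clm_bundle_apply hτ
      rw [mdifferentiableAt_section] at this
      exact this
    have h3 : (fun y => β y ((σ + τ) y)) = (fun y => β y (σ y)) + (fun y => β y (τ y)) := by
      ext y; simp
    have : IsManifold 𝓘(ℝ, E) (minSmoothness ℝ 2) M := by
      simp; infer_instance
    rw [h3, mvfderiv_add h1 h2, VectorField.mlieBracket_add_right hσ hτ]
    simp
    ring

section FiniteDim

variable [FiniteDimensional ℝ E]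

/-- The value at `x` of the Lie derivative `ℒ_X β`: the covector determined by
`(ℒ_X β)(Y) = X(β(Y)) - β([X, Y])`. -/
def lieDerivativeAt (X : VectorFields E M) (β : OneForms E M) (x : M) : CotangentFiber E x :=
  TensorialAt.mkHom _ x (tensorialAt_lieDerivative X β x)

theorem lieDerivativeAt_apply (X : VectorFields E M) (β : OneForms E M) (x : M)
    {Y : ∀ y : M, TangentSpace 𝓘(ℝ, E) y}
    (hY : MDifferentiableAt 𝓘(ℝ, E) (𝓘(ℝ, E).prod 𝓘(ℝ, E))
      (fun y => TotalSpace.mk' E y (Y y)) x) :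
    lieDerivativeAt X β x (Y x) =
      mvfderiv 𝓘(ℝ, E) (fun y => β y (Y y)) x (X x)
        - β x (VectorField.mlieBracket 𝓘(ℝ, E) X Y x) :=
  TensorialAt.mkHom_apply (tensorialAt_lieDerivative X β x) hY

theorem contMDiffAt_lieDerivativeAt (X : VectorFields E M) (β : OneForms E M) (x₀ : M) :
    ContMDiffAt 𝓘(ℝ, E) (𝓘(ℝ, E).prod 𝓘(ℝ, E →L[ℝ] ℝ)) ∞
      (fun x => TotalSpace.mk' (E →L[ℝ] ℝ) (E := fun x : M => CotangentFiber E x) x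
        (lieDerivativeAt X β x)) x₀ := by
  refine contMDiffAt_oneForm_of_apply fun Y hY => ?_
  have hev : ∀ᶠ x in 𝓝 x₀, MDifferentiableAt 𝓘(ℝ, E) (𝓘(ℝ, E).prod 𝓘(ℝ, E))
      (fun y => TotalSpace.mk' E y (Y y)) x := by
    have h1 : ContMDiffAt 𝓘(ℝ, E) (𝓘(ℝ, E).prod 𝓘(ℝ, E)) 1
      (fun y => TotalSpace.mk' E y (Y y)) x₀ := hY.of_le (by simp)
    filter_upwards [(contMDiffAt_iff_contMDiffAt_nhds (by simp)).1 h1] with x hx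
    exact hx.mdifferentiableAt (by simp)
  have hbr : ContMDiffAt 𝓘(ℝ, E) (𝓘(ℝ, E).prod 𝓘(ℝ, E)) ∞
      (fun y => TotalSpace.mk' E y (VectorField.mlieBracket 𝓘(ℝ, E) X Y y)) x₀ := by
    have : IsManifold 𝓘(ℝ, E) (((⊤ : ℕ∞) : WithTop ℕ∞) + 1) M := by
      simpa using (inferInstance : IsManifold 𝓘(ℝ, E) ∞ M)
    have : IsManifold 𝓘(ℝ, E) (minSmoothness ℝ 2) M := by
      simp; infer_instance
    exact ContMDiffAt.mlieBracket_vectorField (m := ⊤) (n := ⊤) (X.contMDiff x₀) hY (by simp)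
  have h2 := (contMDiffAt_oneForm_apply
    (contMDiffAt_mvfderiv (contMDiffAt_oneForm_apply (β.contMDiff x₀) hY)) (X.contMDiff x₀)).sub
    (contMDiffAt_oneForm_apply (β.contMDiff x₀) hbr)
  refine h2.congr_of_eventuallyEq ?_
  filter_upwards [hev] with x hx
  exact lieDerivativeAt_apply X β x hx

/-- The Lie derivative `ℒ_X β` of a smooth 1-form along a smooth vector field. -/
def lieDerivative (X : VectorFields E M) (β : OneForms E M) : OneForms E M :=
  ⟨lieDerivativeAt X β, contMDiffAt_lieDerivativeAt X β⟩

end FiniteDim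

/-! ### Poisson tensors and the cotangent bracket -/

/-- The vector field `P(α)`. -/
def sharp (P : ContravariantTensors E M) (α : OneForms E M) : VectorFields E M :=
  ⟨fun x => P x (α x), P.contMDiff.clm_bundle_apply α.contMDiff⟩

/-- The function `⟨P, α ∧ β⟩ = ⟨β, P(α)⟩`. -/
def pairing (P : ContravariantTensors E M) (α β : OneForms E M) : C^∞⟮𝓘(ℝ, E), M; ℝ⟯ :=
  applyOneForm β (sharp P α)

/-- The bracket of functions `{f, g}^P = ⟨P, df ∧ dg⟩`. -/
def poissonBracket (P : ContravariantTensors E M) (f g : C^∞⟮𝓘(ℝ, E), M; ℝ⟯) :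
    C^∞⟮𝓘(ℝ, E), M; ℝ⟯ :=
  pairing P (differential f) (differential g)

/-- `P` is a Poisson tensor: a skew-symmetric contravariant 2-tensor whose bracket of functions
satisfies the Jacobi identity. -/
structure IsPoisson (P : ContravariantTensors E M) : Prop where
  skew : ∀ (x : M) (α β : CotangentFiber E x), β (P x α) = -α (P x β)
  jacobi : ∀ f g h : C^∞⟮𝓘(ℝ, E), M; ℝ⟯,
    poissonBracket P f (poissonBracket P g h) + poissonBracket P g (poissonBracket P h f)
      + poissonBracket P h (poissonBracket P f g) = 0

/-- The bracket
`μ^P(α, β) = [α, β]^P = ℒ_{P(α)} β - ℒ_{P(β)} α - d⟨P, α ∧ β⟩` of 1-forms. -/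
def cotangentBracket [FiniteDimensional ℝ E] (P : ContravariantTensors E M)
    (α β : OneForms E M) : OneForms E M :=
  lieDerivative (sharp P α) β - lieDerivative (sharp P β) α - differential (pairing P α β)

/-! ### Contractions of products of 1-forms -/

/-- The 1-form `N(α)`. -/
def applyEnd (N : CotangentEndomorphisms E M) (α : OneForms E M) : OneForms E M :=
  ⟨fun x => N x (α x), N.contMDiff.clm_bundle_apply α.contMDiff⟩

/-- The composition `PN : T*M → TM`. -/
def compEnd (P : ContravariantTensors E M) (N : CotangentEndomorphisms E M) :
    ContravariantTensors E M :=
  ⟨fun x => (P x).comp (N x), fun x => contMDiffAt_comp (P.contMDiff x) (N.contMDiff x)⟩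

/-- `δ_N μ(α, β) = μ(Nα, β) + μ(α, Nβ) - N μ(α, β)`. -/
def deformedProduct (μ : OneForms E M → OneForms E M → OneForms E M)
    (N : CotangentEndomorphisms E M) (α β : OneForms E M) : OneForms E M :=
  μ (applyEnd N α) β + μ α (applyEnd N β) - applyEnd N (μ α β)

/-- The Nijenhuis torsion `T_N μ(α, β) = μ(Nα, Nβ) - N(δ_N μ(α, β))`. -/
def torsion (μ : OneForms E M → OneForms E M → OneForms E M)
    (N : CotangentEndomorphisms E M) (α β : OneForms E M) : OneForms E M :=
  μ (applyEnd N α) (applyEnd N β) - applyEnd N (deformedProduct μ N α β)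

/-- The component `E¹ₓ = Nₓⁿ(T*ₓM)`, `n = dim T*ₓM`, of the Riesz decomposition of `T*ₓM` with
respect to `Nₓ`, on which `Nₓ` is invertible. -/
def rieszComponent (N : CotangentEndomorphisms E M) (x : M) : Submodule ℝ (CotangentFiber E x) :=
  LinearMap.range ((N x : Module.End ℝ (CotangentFiber E x))
    ^ Module.finrank ℝ (CotangentFiber E x))

/-- `N` is a Saletan tensor for `μ`: the Nijenhuis torsion takes values in `N(𝒜¹)`, where `𝒜¹` is
the space of smooth 1-forms with values in the Riesz component `E¹`. -/
def IsSaletan (μ : OneForms E M → OneForms E M → OneForms E M)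
    (N : CotangentEndomorphisms E M) : Prop :=
  ∀ α β : OneForms E M, ∃ τ : OneForms E M,
    (∀ x, τ x ∈ rieszComponent N x) ∧ applyEnd N τ = torsion μ N α β

/-- `ν` is the contraction `μ_N` of `μ` by `N`: with `U(t) = t I + N`,
`ν(α, β) = lim_{t → 0, t ≠ 0} U(t)⁻¹ μ(U(t) α, U(t) β)` at every point. For `t ≠ 0` close to `0`,
depending on the point, `U(t)` is invertible there. -/
def IsContraction (μ : OneForms E M → OneForms E M → OneForms E M)
    (N : CotangentEndomorphisms E M) (ν : OneForms E M → OneForms E M → OneForms E M) : Prop :=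
  ∀ (α β : OneForms E M) (x : M),
    Tendsto (fun t : ℝ =>
        (t • ContinuousLinearMap.id ℝ (CotangentFiber E x) + N x).inverse
          (μ (t • α + applyEnd N α) (t • β + applyEnd N β) x))
      (𝓝[≠] 0) (𝓝 (ν α β x))

/-! ### The dual morphism -/

section Dual

variable [FiniteDimensional ℝ E]

instance finiteDimensional_tangentSpace (x : M) :
    FiniteDimensional ℝ (TangentSpace 𝓘(ℝ, E) x) :=
  inferInstanceAs (FiniteDimensional ℝ E)

instance t2Space_tangentSpace (x : M) : T2Space (TangentSpace 𝓘(ℝ, E) x) :=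
  inferInstanceAs (T2Space E)

/-- `Nₓ` as a linear endomorphism of the algebraic dual of `TₓM`, which is the same space as
`T*ₓM` because `TₓM` is finite-dimensional. -/
def algebraicEnd (N : CotangentEndomorphisms E M) (x : M) :
    Module.Dual ℝ (TangentSpace 𝓘(ℝ, E) x) →ₗ[ℝ] Module.Dual ℝ (TangentSpace 𝓘(ℝ, E) x) :=
  (LinearMap.toContinuousLinearMap
      (𝕜 := ℝ) (E := TangentSpace 𝓘(ℝ, E) x) (F' := ℝ)).symm.toLinearMap ∘ₗ
    (N x).toLinearMap ∘ₗ
    (LinearMap.toContinuousLinearMap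
      (𝕜 := ℝ) (E := TangentSpace 𝓘(ℝ, E) x) (F' := ℝ)).toLinearMap

/-- The dual `ᵗNₓ : TₓM → TₓM` of `Nₓ : T*ₓM → T*ₓM`, using `T**ₓM = TₓM`. -/
def dualEnd (N : CotangentEndomorphisms E M) (x : M) :
    TangentSpace 𝓘(ℝ, E) x →L[ℝ] TangentSpace 𝓘(ℝ, E) x :=
  LinearMap.toContinuousLinearMap
    ((Module.evalEquiv ℝ (TangentSpace 𝓘(ℝ, E) x)).symm.toLinearMap ∘ₗ
      (algebraicEnd N x).dualMap ∘ₗ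
      (Module.evalEquiv ℝ (TangentSpace 𝓘(ℝ, E) x)).toLinearMap)

theorem apply_dualEnd (N : CotangentEndomorphisms E M) (x : M) (α : CotangentFiber E x)
    (v : TangentSpace 𝓘(ℝ, E) x) : α (dualEnd N x v) = N x α v :=
  Module.apply_evalEquiv_symm_apply (R := ℝ) (M := TangentSpace 𝓘(ℝ, E) x)
    (α : TangentSpace 𝓘(ℝ, E) x →ₗ[ℝ] ℝ) _

end Dual

end PoissonContraction

end

open PoissonContraction

noncomputable section

namespace PoissonContraction

/-! ### Contraction limits in finite-dimensional spaces -/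

/-! Write `μ = μ^P`, `δ` for the deformed product and `T` for the torsion. Expanding in `t` gives
`μ(U(t)α, U(t)β) = U(t)(t μ(α,β) + δ(α,β)) + T(α,β)`. The Saletan condition says `T = Nτ` with `τ`
in the Riesz component, where `N` is invertible, so `U(t)⁻¹Nτ → τ` and the contraction is `ν = δ +
τ` (`isContraction_liftedProduct`). Hence `N ν(α,β) = μ(Nα,Nβ)`.

The torsion is function-linear in `β`, and so is `τ`; thus `ν` obeys a Leibniz rule with anchor
`PN`. Since `μ^Q` has anchor `Q`, `ν = μ^Q` forces `Q = PN` (`eq_compEnd_of_liftedProduct_eq`). For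
skew `P`, condition (i) is the skewness of `PN`.

Conversely, the anchor of a Poisson tensor is a morphism of brackets (`sharp_cotangentBracket`), so
`PN ν(α,β) = P μ(Nα,Nβ) = [PNα, PNβ]`. If `ν = μ^{PN}`, the anchor of `PN` is a morphism too, and
this yields the Jacobi identity (`isPoisson_of_sharp_cotangentBracket`). -/

theorem eq_zero_of_mem_range_pow_finrank {V : Type*} [AddCommGroup V] [Module ℝ V]
    [FiniteDimensional ℝ V] {A : Module.End ℝ V} {v : V}
    (hv : v ∈ LinearMap.range (A ^ Module.finrank ℝ V)) (h : A v = 0) : v = 0 := by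
  obtain ⟨w, rfl⟩ := hv
  have h1 : w ∈ LinearMap.ker (A ^ (Module.finrank ℝ V + 1)) := by
    rw [LinearMap.mem_ker, pow_succ']; exact h
  -- Kernels of powers stabilise at the dimension, so one further factor of `A` kills nothing new.
  rwa [Module.End.ker_pow_eq_ker_pow_finrank_of_le (Nat.le_succ _)] at h1

theorem apply_mem_range_pow {V : Type*} [AddCommGroup V] [Module ℝ V] {A : Module.End ℝ V}
    {n : ℕ} {v : V} (hv : v ∈ LinearMap.range (A ^ n)) :
    A v ∈ LinearMap.range (A ^ n) := by
  obtain ⟨w, rfl⟩ := hv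
  exact ⟨A w, by rw [← Module.End.mul_apply, ← pow_succ, pow_succ', Module.End.mul_apply]⟩

section Limit

variable {V : Type*} [AddCommGroup V] [Module ℝ V] [TopologicalSpace V] [IsTopologicalAddGroup V]
  [ContinuousSMul ℝ V] [T2Space V] [FiniteDimensional ℝ V]

theorem isInvertible_of_injective {A : V →L[ℝ] V} (hA : Function.Injective A) :
    A.IsInvertible :=
  ⟨(LinearEquiv.ofInjectiveEndo (A : V →ₗ[ℝ] V) hA).toContinuousLinearEquiv, by ext v; rfl⟩

/-- Invertibility fails only when `-t` is an eigenvalue of `A`, which excludes finitely many `t`. -/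
theorem eventually_isInvertible_smul_id_add (A : V →L[ℝ] V) :
    ∀ᶠ t in 𝓝[≠] (0 : ℝ), (t • ContinuousLinearMap.id ℝ V + A).IsInvertible := by
  have hfin : {t : ℝ | Module.End.HasEigenvalue (A : Module.End ℝ V) (-t)}.Finite :=
    (Module.End.finite_hasEigenvalue (A : Module.End ℝ V)).preimage neg_injective.injOn
  have h0 : ∀ᶠ t in 𝓝[≠] (0 : ℝ), ¬ Module.End.HasEigenvalue (A : Module.End ℝ V) (-t) :=
    nhdsNE_le_cofinite 0 hfin.compl_mem_cofinite
  filter_upwards [h0] with t ht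
  refine isInvertible_of_injective ((injective_iff_map_eq_zero _).2 fun v hv => ?_)
  by_contra hv0
  refine ht (Module.End.hasEigenvalue_of_hasEigenvector
    (Module.End.hasEigenvector_iff.2 ⟨Module.End.mem_eigenspace_iff.2 ?_, hv0⟩))
  have h : t • v + A v = 0 := hv
  rw [neg_smul]
  exact (neg_eq_of_add_eq_zero_right h).symm

/-- The Riesz component is stable under `A`, and `A` is invertible on it, so the claim reduces there
to continuity of inversion at an invertible operator. `A` itself may be singular. -/
theorem tendsto_inverse_smul_id_add_apply (A : V →L[ℝ] V) {τ : V}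
    (hτ : τ ∈ LinearMap.range ((A : Module.End ℝ V) ^ Module.finrank ℝ V)) :
    Tendsto (fun t : ℝ => (t • ContinuousLinearMap.id ℝ V + A).inverse (A τ)) (𝓝[≠] 0) (𝓝 τ) := by
  let W := LinearMap.range ((A : Module.End ℝ V) ^ Module.finrank ℝ V)
  let AW : W →ₗ[ℝ] W := (A : Module.End ℝ V).restrict fun v hv => apply_mem_range_pow hv
  -- `V` carries only a vector space topology; coordinates move the problem to a normed space.
  let e : W ≃L[ℝ] (Fin (Module.finrank ℝ W) → ℝ) := ContinuousLinearEquiv.ofFinrankEq (by simp)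
  let C : (Fin (Module.finrank ℝ W) → ℝ) →L[ℝ] (Fin (Module.finrank ℝ W) → ℝ) :=
    (e : W →L[ℝ] _) ∘L LinearMap.toContinuousLinearMap AW ∘L (e.symm : _ →L[ℝ] W)
  have hC : C.IsInvertible := by
    refine isInvertible_of_injective ((injective_iff_map_eq_zero _).2 fun v hv => ?_)
    have h1 : AW (e.symm v) = 0 := e.map_eq_zero_iff.1 hv
    have h2 : e.symm v = 0 :=
      Subtype.ext (eq_zero_of_mem_range_pow_finrank (e.symm v).2 (congrArg Subtype.val h1))
    exact e.symm.map_eq_zero_iff.1 h2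
  have hCA : ∀ w : W, C (e w) = e (AW w) := fun w => by simp [C]
  have hlim : Tendsto (fun t : ℝ => (t • ContinuousLinearMap.id ℝ _ + C)) (𝓝 0) (𝓝 C) := by
    have : Continuous fun t : ℝ => (t • ContinuousLinearMap.id ℝ _ + C) := by fun_prop
    simpa using this.tendsto 0
  have hcont : ContinuousAt ContinuousLinearMap.inverse C := by
    obtain ⟨C', hC'⟩ := hC
    rw [← hC']
    exact (contDiffAt_map_inverse (n := 0) C').continuousAt
  have hopen : ∀ᶠ t in 𝓝 (0 : ℝ), (t • ContinuousLinearMap.id ℝ _ + C).IsInvertible := by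
    have : {D : (Fin (Module.finrank ℝ W) → ℝ) →L[ℝ] (Fin (Module.finrank ℝ W) → ℝ) |
      D.IsInvertible} ∈ 𝓝 C := by
      obtain ⟨C', hC'⟩ := hC
      rw [← hC']
      exact C'.nhds
    exact hlim this
  have hmain : Tendsto (fun t : ℝ => ((e.symm ((t • ContinuousLinearMap.id ℝ _ + C).inverse
      (C (e ⟨τ, hτ⟩))) : W) : V)) (𝓝 0) (𝓝 τ) := by
    have h1 : Tendsto (fun t : ℝ => (t • ContinuousLinearMap.id ℝ _ + C).inverse
      (C (e ⟨τ, hτ⟩))) (𝓝 0) (𝓝 (C.inverse (C (e ⟨τ, hτ⟩)))) :=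
      ((ContinuousLinearMap.apply ℝ _ (C (e ⟨τ, hτ⟩))).continuous.tendsto _).comp
        (hcont.tendsto.comp hlim)
    rw [hC.inverse_apply_self] at h1
    have h2 := (continuous_subtype_val.tendsto _).comp ((e.symm.continuous.tendsto _).comp h1)
    simpa [Function.comp_def] using h2
  refine (hmain.mono_left nhdsWithin_le_nhds).congr' ?_
  filter_upwards [eventually_isInvertible_smul_id_add A, hopen.filter_mono nhdsWithin_le_nhds]
    with t ht ht'
  -- The solution `w` of `t w + A w = A τ` found in `W` is also the solution in `V`.
  generalize hw : e.symm ((t • ContinuousLinearMap.id ℝ _ + C).inverse (C (e ⟨τ, hτ⟩))) = w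
  rw [e.symm_apply_eq, ht'.inverse_apply_eq, hCA] at hw
  have h : e (AW ⟨τ, hτ⟩) = e (t • w + AW w) := by
    rw [hw, map_add, map_smul, ← hCA]; rfl
  exact ((ht.inverse_apply_eq).2 (congrArg Subtype.val (e.injective h))).symm

end Limit

section

variable {E : Type*} [NormedAddCommGroup E] [NormedSpace ℝ E]
  {M : Type*} [TopologicalSpace M] [ChartedSpace E M]

/-! ### Vector fields as derivations -/

/-- In the commutator the second derivatives of `g` cancel by symmetry. -/
theorem fderiv_lieBracket {g : E → ℝ} {X Y : E → E} {z : E} (hg : ContDiffAt ℝ 2 g z)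
    (hX : DifferentiableAt ℝ X z) (hY : DifferentiableAt ℝ Y z) :
    fderiv ℝ g z (VectorField.lieBracket ℝ X Y z) =
      fderiv ℝ (fun y => fderiv ℝ g y (Y y)) z (X z)
        - fderiv ℝ (fun y => fderiv ℝ g y (X y)) z (Y z) := by
  have hd : DifferentiableAt ℝ (fderiv ℝ g) z :=
    (hg.fderiv_right (m := 1) (by norm_num)).differentiableAt (by norm_num)
  have hs : IsSymmSndFDerivAt ℝ g z := hg.isSymmSndFDerivAt (by simp)
  rw [fderiv_clm_apply hd hY, fderiv_clm_apply hd hX, VectorField.lieBracket]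
  simp [hs.eq (X z) (Y z)]

theorem mvfderiv_eq_fderiv_comp_extChartAt_symm {g : M → ℝ} {x : M}
    (hg : MDifferentiableAt 𝓘(ℝ, E) 𝓘(ℝ, ℝ) g x) (v : TangentSpace 𝓘(ℝ, E) x) :
    mvfderiv 𝓘(ℝ, E) g x v =
      fderiv ℝ (g ∘ (extChartAt 𝓘(ℝ, E) x).symm) (extChartAt 𝓘(ℝ, E) x x) v := by
  rw [hg.mvfderiv]
  simp [writtenInExtChartAt]
  rfl

variable [IsManifold 𝓘(ℝ, E) ∞ M]

/-- By the chain rule, the derivative of the inverse chart cancels the inverse derivative in the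
pullback. -/
theorem fderiv_comp_extChartAt_symm_mpullbackWithin {g : M → ℝ} {x : M} {z : E}
    (hz : z ∈ (extChartAt 𝓘(ℝ, E) x).target)
    (hg : MDifferentiableAt 𝓘(ℝ, E) 𝓘(ℝ, ℝ) g ((extChartAt 𝓘(ℝ, E) x).symm z))
    (X : ∀ y : M, TangentSpace 𝓘(ℝ, E) y) :
    fderiv ℝ (g ∘ (extChartAt 𝓘(ℝ, E) x).symm) z
        (VectorField.mpullbackWithin 𝓘(ℝ, E) 𝓘(ℝ, E) (extChartAt 𝓘(ℝ, E) x).symm X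
          (Set.range 𝓘(ℝ, E)) z) =
      mvfderiv 𝓘(ℝ, E) g ((extChartAt 𝓘(ℝ, E) x).symm z) (X ((extChartAt 𝓘(ℝ, E) x).symm z)) := by
  have h1 := mdifferentiableWithinAt_extChartAt_symm (I := 𝓘(ℝ, E)) hz
  have h2 := mfderiv_comp_mfderivWithin z hg h1
    (𝓘(ℝ, E).uniqueMDiffOn z (extChartAt_target_subset_range x hz))
  have h3 : fderiv ℝ (g ∘ (extChartAt 𝓘(ℝ, E) x).symm) z =
      (mfderiv 𝓘(ℝ, E) 𝓘(ℝ, ℝ) g ((extChartAt 𝓘(ℝ, E) x).symm z)).comp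
        (mfderivWithin 𝓘(ℝ, E) 𝓘(ℝ, E) (extChartAt 𝓘(ℝ, E) x).symm (Set.range 𝓘(ℝ, E)) z) := by
    rw [← h2]; simp [mfderivWithin_eq_fderivWithin]
  rw [h3]
  exact congrArg (mfderiv 𝓘(ℝ, E) 𝓘(ℝ, ℝ) g ((extChartAt 𝓘(ℝ, E) x).symm z))
    ((isInvertible_mfderivWithin_extChartAt_symm hz).self_apply_inverse _)

theorem mpullbackWithin_extChartAt_symm_self (X : ∀ y : M, TangentSpace 𝓘(ℝ, E) y) (x : M) :
    VectorField.mpullbackWithin 𝓘(ℝ, E) 𝓘(ℝ, E) (extChartAt 𝓘(ℝ, E) x).symm X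
      (Set.range 𝓘(ℝ, E)) (extChartAt 𝓘(ℝ, E) x x) = (X x : E) := by
  have h := mfderivWithin_extChartAt_symm_inverse_apply (I := 𝓘(ℝ, E)) (x := x)
    (X ((extChartAt 𝓘(ℝ, E) x).symm (extChartAt 𝓘(ℝ, E) x x)))
  refine Eq.trans h ?_
  rw [extChartAt_to_inv]

theorem mdifferentiableAt_oneForm_apply {φ : ∀ x : M, CotangentFiber E x}
    {Y : ∀ x : M, TangentSpace 𝓘(ℝ, E) x} {x₀ : M}
    (hφ : MDifferentiableAt 𝓘(ℝ, E) (𝓘(ℝ, E).prod 𝓘(ℝ, E →L[ℝ] ℝ))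
      (fun x => TotalSpace.mk' (E →L[ℝ] ℝ) (E := fun x : M => CotangentFiber E x) x (φ x)) x₀)
    (hY : MDifferentiableAt 𝓘(ℝ, E) (𝓘(ℝ, E).prod 𝓘(ℝ, E))
      (fun x => TotalSpace.mk' E x (Y x)) x₀) :
    MDifferentiableAt 𝓘(ℝ, E) 𝓘(ℝ, ℝ) (fun x => φ x (Y x)) x₀ := by
  have := hφ.clm_bundle_apply hY
  rw [mdifferentiableAt_section] at this
  exact this

theorem mdifferentiableAt_mvfderiv_apply {g : M → ℝ} {X : ∀ y : M, TangentSpace 𝓘(ℝ, E) y} {x : M}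
    (hg : ContMDiffAt 𝓘(ℝ, E) 𝓘(ℝ, ℝ) ∞ g x)
    (hX : MDifferentiableAt 𝓘(ℝ, E) (𝓘(ℝ, E).prod 𝓘(ℝ, E))
      (fun y => TotalSpace.mk' E y (X y)) x) :
    MDifferentiableAt 𝓘(ℝ, E) 𝓘(ℝ, ℝ) (fun y => mvfderiv 𝓘(ℝ, E) g y (X y)) x :=
  mdifferentiableAt_oneForm_apply ((contMDiffAt_mvfderiv hg).mdifferentiableAt (by simp)) hX

/-- The derivative of a function along a Lie bracket is the commutator of its derivatives. -/
theorem mvfderiv_mlieBracket [CompleteSpace E] {g : M → ℝ}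
    {X Y : ∀ y : M, TangentSpace 𝓘(ℝ, E) y} {x : M}
    (hg : ContMDiff 𝓘(ℝ, E) 𝓘(ℝ, ℝ) ∞ g)
    (hX : MDifferentiableAt 𝓘(ℝ, E) (𝓘(ℝ, E).prod 𝓘(ℝ, E)) (fun y => TotalSpace.mk' E y (X y)) x)
    (hY : MDifferentiableAt 𝓘(ℝ, E) (𝓘(ℝ, E).prod 𝓘(ℝ, E)) (fun y => TotalSpace.mk' E y (Y y)) x) :
    mvfderiv 𝓘(ℝ, E) g x (VectorField.mlieBracket 𝓘(ℝ, E) X Y x) =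
      mvfderiv 𝓘(ℝ, E) (fun y => mvfderiv 𝓘(ℝ, E) g y (Y y)) x (X x)
        - mvfderiv 𝓘(ℝ, E) (fun y => mvfderiv 𝓘(ℝ, E) g y (X y)) x (Y x) := by
  have hdiff : ∀ y, MDifferentiableAt 𝓘(ℝ, E) 𝓘(ℝ, ℝ) g y :=
    fun y => (hg y).mdifferentiableAt (by simp)
  let φ := extChartAt 𝓘(ℝ, E) x
  let pull (Z : ∀ y : M, TangentSpace 𝓘(ℝ, E) y) : E → E :=
    VectorField.mpullbackWithin 𝓘(ℝ, E) 𝓘(ℝ, E) φ.symm Z (Set.range 𝓘(ℝ, E))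
  have hpull : ∀ {Z : ∀ y : M, TangentSpace 𝓘(ℝ, E) y}, MDifferentiableAt 𝓘(ℝ, E)
      (𝓘(ℝ, E).prod 𝓘(ℝ, E)) (fun y => TotalSpace.mk' E y (Z y)) x →
      DifferentiableAt ℝ (pull Z) (φ x) := by
    intro Z hZ
    have : IsManifold 𝓘(ℝ, E) 2 M := inferInstance
    have := (mdifferentiableWithinAt_univ.2 hZ).differentiableWithinAt_mpullbackWithin_vectorField
    exact this.differentiableAt (by simp)
  -- The chart formula holds on a neighbourhood, so it may be differentiated once more.
  have hderiv : ∀ Z : ∀ y : M, TangentSpace 𝓘(ℝ, E) y,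
      (fun z => fderiv ℝ (g ∘ φ.symm) z (pull Z z)) =ᶠ[𝓝 (φ x)]
        (fun y => mvfderiv 𝓘(ℝ, E) g y (Z y)) ∘ φ.symm := by
    intro Z
    filter_upwards [extChartAt_target_mem_nhds (I := 𝓘(ℝ, E)) x] with z hz
    exact fderiv_comp_extChartAt_symm_mpullbackWithin hz (hdiff _) Z
  have hsecond : ∀ {Z : ∀ y : M, TangentSpace 𝓘(ℝ, E) y}, MDifferentiableAt 𝓘(ℝ, E)
      (𝓘(ℝ, E).prod 𝓘(ℝ, E)) (fun y => TotalSpace.mk' E y (Z y)) x →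
      ∀ Z' : ∀ y : M, TangentSpace 𝓘(ℝ, E) y,
        mvfderiv 𝓘(ℝ, E) (fun y => mvfderiv 𝓘(ℝ, E) g y (Z y)) x (Z' x) =
          fderiv ℝ (fun z => fderiv ℝ (g ∘ φ.symm) z (pull Z z)) (φ x) (pull Z' (φ x)) := by
    intro Z hZ Z'
    rw [(hderiv Z).fderiv_eq,
      mvfderiv_eq_fderiv_comp_extChartAt_symm (mdifferentiableAt_mvfderiv_apply (hg x) hZ)]
    exact congrArg _ (mpullbackWithin_extChartAt_symm_self Z' x).symm
  have hg' : ContDiffAt ℝ 2 (g ∘ φ.symm) (φ x) := by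
    have h := ((hg _).comp_contMDiffWithinAt (φ x)
      (contMDiffWithinAt_extChartAt_symm_range (n := ∞) (I := 𝓘(ℝ, E)) x
        (mem_extChartAt_target x))).contDiffWithinAt
    rw [𝓘(ℝ, E).range_eq_univ, contDiffWithinAt_univ] at h
    exact h.of_le (WithTop.coe_le_coe.2 (le_top : (2 : ℕ∞) ≤ ⊤))
  -- The derivative of the chart at its own centre is the identity, so the bracket at `x` is the
  -- bracket of the chart representatives.
  have hbr : VectorField.mlieBracket 𝓘(ℝ, E) X Y x =
      (VectorField.lieBracket ℝ (pull X) (pull Y) (φ x) : E) := by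
    rw [← VectorField.mlieBracketWithin_univ, VectorField.mlieBracketWithin_apply,
      mfderiv_extChartAt_self]
    refine (congrFun (congrArg DFunLike.coe ContinuousLinearMap.inverse_id) _).trans ?_
    have hset : φ.symm ⁻¹' Set.univ ∩ Set.range 𝓘(ℝ, E) = Set.univ := by simp
    change VectorField.lieBracketWithin ℝ (pull X) (pull Y)
      (φ.symm ⁻¹' Set.univ ∩ Set.range 𝓘(ℝ, E)) (φ x) = _
    rw [hset, VectorField.lieBracketWithin_univ]
  rw [hsecond hY X, hsecond hX Y, ← fderiv_lieBracket hg' (hpull hX) (hpull hY),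
    mvfderiv_eq_fderiv_comp_extChartAt_symm (hdiff x)]
  exact congrArg _ hbr

/-- A linear function of the chart, cut off by a bump function, works; Hausdorffness makes the
extension by zero smooth. -/
theorem exists_differential_eq [FiniteDimensional ℝ E] [T2Space M] (x : M)
    (a : CotangentFiber E x) : ∃ f : C^∞⟮𝓘(ℝ, E), M; ℝ⟯, differential f x = a := by
  obtain ⟨χ⟩ : Nonempty (SmoothBumpFunction 𝓘(ℝ, E) x) := inferInstance
  let a' : E →L[ℝ] ℝ := a
  have hs : ContMDiffOn 𝓘(ℝ, E) 𝓘(ℝ, ℝ) ∞ (fun y => a' (extChartAt 𝓘(ℝ, E) x y))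
      (chartAt E x).source :=
    a'.contMDiff.comp_contMDiffOn contMDiffOn_extChartAt
  refine ⟨⟨_, χ.contMDiff_smul hs⟩, ?_⟩
  have h1 : (fun y => χ y • a' (extChartAt 𝓘(ℝ, E) x y)) =ᶠ[𝓝 x]
      a' ∘ (extChartAt 𝓘(ℝ, E) x) := by
    filter_upwards [χ.eventuallyEq_one] with y hy
    simp [hy]
  have h2 : mfderiv 𝓘(ℝ, E) 𝓘(ℝ, ℝ) (fun y => χ y • a' (extChartAt 𝓘(ℝ, E) x y)) x =
      (mfderiv 𝓘(ℝ, E) 𝓘(ℝ, ℝ) a' (extChartAt 𝓘(ℝ, E) x x)).comp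
        (mfderiv 𝓘(ℝ, E) 𝓘(ℝ, E) (extChartAt 𝓘(ℝ, E) x) x) := by
    rw [h1.mfderiv_eq]
    exact mfderiv_comp x a'.mdifferentiableAt
      (mdifferentiableAt_extChartAt (mem_chart_source E x))
  ext v
  change mfderiv 𝓘(ℝ, E) 𝓘(ℝ, ℝ) (fun y => χ y • a' (extChartAt 𝓘(ℝ, E) x y)) x v = a v
  rw [h2, mfderiv_extChartAt_self, mfderiv_eq_fderiv, a'.fderiv]
  rfl

end

section

variable {E : Type*} [NormedAddCommGroup E] [NormedSpace ℝ E]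
  {M : Type*} [TopologicalSpace M] [ChartedSpace E M] [IsManifold 𝓘(ℝ, E) ∞ M]

/-! ### The cotangent bracket on differentiable sections -/

/-- Differentiability at `x` of a section of `TM`. -/
abbrev VectorDiffAt (Y : ∀ y : M, TangentSpace 𝓘(ℝ, E) y) (x : M) : Prop :=
  MDifferentiableAt 𝓘(ℝ, E) (𝓘(ℝ, E).prod 𝓘(ℝ, E)) (fun y => TotalSpace.mk' E y (Y y)) x

/-- Differentiability at `x` of a section of `T*M`. -/
abbrev FormDiffAt (σ : ∀ y : M, CotangentFiber E y) (x : M) : Prop :=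
  MDifferentiableAt 𝓘(ℝ, E) (𝓘(ℝ, E).prod 𝓘(ℝ, E →L[ℝ] ℝ))
    (fun y => TotalSpace.mk' (E →L[ℝ] ℝ) (E := fun y : M => CotangentFiber E y) y (σ y)) x

theorem formDiffAt (α : OneForms E M) (x : M) : FormDiffAt α x :=
  α.mdifferentiableAt

/-- The section `P(σ)` of `TM` for a section `σ` of `T*M`. -/
def rawSharp (P : ContravariantTensors E M) (σ : ∀ y : M, CotangentFiber E y) :
    ∀ y : M, TangentSpace 𝓘(ℝ, E) y :=
  fun y => P y (σ y)

theorem vectorDiffAt_rawSharp (P : ContravariantTensors E M) {σ : ∀ y : M, CotangentFiber E y}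
    {x : M} (hσ : FormDiffAt σ x) : VectorDiffAt (rawSharp P σ) x :=
  (P.mdifferentiableAt (x := x)).clm_bundle_apply hσ

theorem rawSharp_add (P : ContravariantTensors E M) (σ τ : ∀ y : M, CotangentFiber E y) :
    rawSharp P (σ + τ) = rawSharp P σ + rawSharp P τ := by
  ext y; simp [rawSharp]

theorem rawSharp_smul (P : ContravariantTensors E M) (f : M → ℝ)
    (τ : ∀ y : M, CotangentFiber E y) : rawSharp P (f • τ) = f • rawSharp P τ := by
  ext y; simp [rawSharp]

/-- Skew-symmetry of a contravariant 2-tensor. -/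
def IsSkew (P : ContravariantTensors E M) : Prop :=
  ∀ (x : M) (α β : CotangentFiber E x), β (P x α) = -α (P x β)

/-- The value at `x` of the bracket of the sections `σ`, `τ` of `T*M`, evaluated on `Y`. -/
def rawBracket (P : ContravariantTensors E M) (σ τ : ∀ y : M, CotangentFiber E y)
    (Y : ∀ y : M, TangentSpace 𝓘(ℝ, E) y) (x : M) : ℝ :=
  (mvfderiv 𝓘(ℝ, E) (fun y => τ y (Y y)) x (rawSharp P σ x)
      - τ x (VectorField.mlieBracket 𝓘(ℝ, E) (rawSharp P σ) Y x))
    - (mvfderiv 𝓘(ℝ, E) (fun y => σ y (Y y)) x (rawSharp P τ x)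
      - σ x (VectorField.mlieBracket 𝓘(ℝ, E) (rawSharp P τ) Y x))
    - mvfderiv 𝓘(ℝ, E) (fun y => τ y (rawSharp P σ y)) x (Y x)

theorem rawBracket_swap {P : ContravariantTensors E M} (hP : IsSkew P)
    (σ τ : ∀ y : M, CotangentFiber E y) (Y : ∀ y : M, TangentSpace 𝓘(ℝ, E) y) (x : M) :
    rawBracket P σ τ Y x = -rawBracket P τ σ Y x := by
  have h : (fun y => τ y (rawSharp P σ y)) = -fun y => σ y (rawSharp P τ y) :=
    funext fun y => hP y (σ y) (τ y)
  simp only [rawBracket, h, mvfderiv_neg, neg_apply]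
  ring

theorem isManifold_minSmoothness_two : IsManifold 𝓘(ℝ, E) (minSmoothness ℝ 2) M := by
  simp; infer_instance

section Complete

variable [CompleteSpace E]

theorem rawBracket_add_right (P : ContravariantTensors E M)
    {σ τ τ' : ∀ y : M, CotangentFiber E y} {Y : ∀ y : M, TangentSpace 𝓘(ℝ, E) y} {x : M}
    (hσ : FormDiffAt σ x) (hτ : FormDiffAt τ x) (hτ' : FormDiffAt τ' x) (hY : VectorDiffAt Y x) :
    rawBracket P σ (τ + τ') Y x = rawBracket P σ τ Y x + rawBracket P σ τ' Y x := by
  have := isManifold_minSmoothness_two (E := E) (M := M)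
  have h1 : (fun y => (τ + τ') y (Y y)) = (fun y => τ y (Y y)) + fun y => τ' y (Y y) := rfl
  have h2 : (fun y => (τ + τ') y (rawSharp P σ y)) =
    (fun y => τ y (rawSharp P σ y)) + fun y => τ' y (rawSharp P σ y) := rfl
  simp only [rawBracket, rawSharp_add, h1, h2]
  rw [mvfderiv_add (mdifferentiableAt_oneForm_apply hτ hY) (mdifferentiableAt_oneForm_apply hτ' hY),
    mvfderiv_add (mdifferentiableAt_oneForm_apply hτ (vectorDiffAt_rawSharp P hσ))
      (mdifferentiableAt_oneForm_apply hτ' (vectorDiffAt_rawSharp P hσ)),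
    VectorField.mlieBracket_add_left (vectorDiffAt_rawSharp P hτ) (vectorDiffAt_rawSharp P hτ')]
  simp only [Pi.add_apply, add_apply, map_add]
  ring

/-- The Leibniz rule. -/
theorem rawBracket_smul_right {P : ContravariantTensors E M} (hP : IsSkew P)
    {σ τ : ∀ y : M, CotangentFiber E y} {Y : ∀ y : M, TangentSpace 𝓘(ℝ, E) y} {f : M → ℝ} {x : M}
    (hf : MDifferentiableAt 𝓘(ℝ, E) 𝓘(ℝ, ℝ) f x)
    (hσ : FormDiffAt σ x) (hτ : FormDiffAt τ x) (hY : VectorDiffAt Y x) :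
    rawBracket P σ (f • τ) Y x =
      f x * rawBracket P σ τ Y x + mvfderiv 𝓘(ℝ, E) f x (rawSharp P σ x) * τ x (Y x) := by
  have := isManifold_minSmoothness_two (E := E) (M := M)
  have h1 : (fun y => (f • τ) y (Y y)) = f * fun y => τ y (Y y) := rfl
  have h2 : (fun y => (f • τ) y (rawSharp P σ y)) = f * fun y => τ y (rawSharp P σ y) := rfl
  -- Skewness cancels the two terms containing `Y f`: one from the bracket `[f P(τ), Y]`, one from
  -- the differential of the pairing.
  have h3 : τ x (rawSharp P σ x) = -σ x (rawSharp P τ x) := hP x (σ x) (τ x)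
  simp only [rawBracket, rawSharp_smul, h1, h2]
  rw [mvfderiv_mul hf (mdifferentiableAt_oneForm_apply hτ hY),
    mvfderiv_mul hf (mdifferentiableAt_oneForm_apply hτ (vectorDiffAt_rawSharp P hσ)),
    VectorField.mlieBracket_smul_left hf (vectorDiffAt_rawSharp P hτ)]
  simp only [Pi.smul_apply', add_apply, smul_apply, map_add,
    map_smul, smul_eq_mul, h3]
  ring

/-- Lie derivatives commute with `d`, so the three terms are `d{f,g} - d{g,f} - d{f,g}`, and
skewness leaves `d{f,g}`. -/
theorem rawBracket_mvfderiv {P : ContravariantTensors E M} (hP : IsSkew P)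
    (f g : C^∞⟮𝓘(ℝ, E), M; ℝ⟯) {Y : ∀ y : M, TangentSpace 𝓘(ℝ, E) y} {x : M}
    (hY : VectorDiffAt Y x) :
    rawBracket P (differential f) (differential g) Y x =
      differential (poissonBracket P f g) x (Y x) := by
  have hcomm (k l : C^∞⟮𝓘(ℝ, E), M; ℝ⟯) :
      differential l x (VectorField.mlieBracket 𝓘(ℝ, E) (rawSharp P (differential k)) Y x) =
        mvfderiv 𝓘(ℝ, E) (fun y => differential l y (Y y)) x (rawSharp P (differential k) x)
          - mvfderiv 𝓘(ℝ, E) (fun y => differential l y (rawSharp P (differential k) y)) x (Y x) :=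
    mvfderiv_mlieBracket l.contMDiff (vectorDiffAt_rawSharp P (formDiffAt (differential k) x)) hY
  have hskew : (fun y => differential f y (rawSharp P (differential g) y)) =
      -fun y => differential g y (rawSharp P (differential f) y) :=
    funext fun y => hP y (differential g y) (differential f y)
  have hbracket : differential (poissonBracket P f g) x (Y x) =
    mvfderiv 𝓘(ℝ, E) (fun y => differential g y (rawSharp P (differential f) y)) x (Y x) := rfl
  rw [hbracket, rawBracket, hcomm f g, hcomm g f, hskew, mvfderiv_neg, neg_apply]
  ring

end Complete

theorem exists_vectorDiffAt_eq {x : M} (v : TangentSpace 𝓘(ℝ, E) x) :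
    ∃ Y : ∀ y : M, TangentSpace 𝓘(ℝ, E) y, VectorDiffAt Y x ∧ Y x = v :=
  ⟨FiberBundle.extend E v, FiberBundle.mdifferentiableAt_extend .., by simp⟩

/-- The product `f β` of a smooth function and a 1-form. -/
def smulForm (f : C^∞⟮𝓘(ℝ, E), M; ℝ⟯) (β : OneForms E M) : OneForms E M :=
  ⟨fun x => f x • β x, fun x => (f.contMDiff x).smul_section (β.contMDiff x)⟩

/-! ### The anchor of a Poisson tensor is a morphism of brackets -/

/-- The defect of `P` being a morphism of brackets, evaluated on `dh`. -/
def anchorDefect (P : ContravariantTensors E M) (h : C^∞⟮𝓘(ℝ, E), M; ℝ⟯) (x : M)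
    (σ τ : ∀ y : M, CotangentFiber E y) : ℝ :=
  rawBracket P σ τ (sharp P (differential h)) x
    + differential h x (VectorField.mlieBracket 𝓘(ℝ, E) (rawSharp P σ) (rawSharp P τ) x)

theorem anchorDefect_swap {P : ContravariantTensors E M} (hP : IsSkew P)
    (h : C^∞⟮𝓘(ℝ, E), M; ℝ⟯) (x : M) (σ τ : ∀ y : M, CotangentFiber E y) :
    anchorDefect P h x σ τ = -anchorDefect P h x τ σ := by
  rw [anchorDefect, rawBracket_swap hP, VectorField.mlieBracket_swap_apply, map_neg, anchorDefect]
  ring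

theorem poissonBracket_swap {P : ContravariantTensors E M} (hP : IsSkew P)
    (f g : C^∞⟮𝓘(ℝ, E), M; ℝ⟯) : poissonBracket P f g = -poissonBracket P g f :=
  ContMDiffMap.ext fun x => hP x (differential f x) (differential g x)

theorem poissonBracket_neg_right_apply (P : ContravariantTensors E M)
    (f g : C^∞⟮𝓘(ℝ, E), M; ℝ⟯) (x : M) :
    poissonBracket P f (-g) x = -poissonBracket P f g x := by
  have h : differential (-g) x = -differential g x := mvfderiv_neg
  exact congrArg (fun a : CotangentFiber E x => a (P x (differential f x))) h

section FiniteDim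

variable [FiniteDimensional ℝ E]

/-! ### Algebraic rules for the cotangent bracket of smooth 1-forms -/

theorem cotangentBracket_apply (P : ContravariantTensors E M) (α β : OneForms E M) {x : M}
    {Y : ∀ y : M, TangentSpace 𝓘(ℝ, E) y} (hY : VectorDiffAt Y x) :
    cotangentBracket P α β x (Y x) = rawBracket P α β Y x := by
  have h1 := lieDerivativeAt_apply (sharp P α) β x hY
  have h2 := lieDerivativeAt_apply (sharp P β) α x hY
  change lieDerivativeAt (sharp P α) β x (Y x) - lieDerivativeAt (sharp P β) α x (Y x)
    - differential (pairing P α β) x (Y x) = _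
  rw [h1, h2]
  rfl

theorem cotangentBracket_differential {P : ContravariantTensors E M} (hP : IsSkew P)
    (f g : C^∞⟮𝓘(ℝ, E), M; ℝ⟯) :
    cotangentBracket P (differential f) (differential g) = differential (poissonBracket P f g) := by
  ext x v
  obtain ⟨Y, hY, rfl⟩ := exists_vectorDiffAt_eq v
  exact (cotangentBracket_apply P _ _ hY).trans (rawBracket_mvfderiv hP f g hY)

theorem cotangentBracket_swap {P : ContravariantTensors E M} (hP : IsSkew P)
    (α β : OneForms E M) : cotangentBracket P α β = -cotangentBracket P β α := by
  ext x v
  obtain ⟨Y, hY, rfl⟩ := exists_vectorDiffAt_eq v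
  change cotangentBracket P α β x (Y x) = -cotangentBracket P β α x (Y x)
  rw [cotangentBracket_apply P _ _ hY, cotangentBracket_apply P _ _ hY, rawBracket_swap hP]

theorem cotangentBracket_add_right (P : ContravariantTensors E M) (α β γ : OneForms E M) :
    cotangentBracket P α (β + γ) = cotangentBracket P α β + cotangentBracket P α γ := by
  ext x v
  obtain ⟨Y, hY, rfl⟩ := exists_vectorDiffAt_eq v
  change cotangentBracket P α (β + γ) x (Y x) =
    cotangentBracket P α β x (Y x) + cotangentBracket P α γ x (Y x)
  rw [cotangentBracket_apply P _ _ hY, cotangentBracket_apply P _ _ hY,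
    cotangentBracket_apply P _ _ hY, ← rawBracket_add_right P (formDiffAt α x) (formDiffAt β x)
    (formDiffAt γ x) hY]
  rfl

theorem cotangentBracket_smulForm_right {P : ContravariantTensors E M} (hP : IsSkew P)
    (f : C^∞⟮𝓘(ℝ, E), M; ℝ⟯) (α β : OneForms E M) (x : M) :
    cotangentBracket P α (smulForm f β) x =
      f x • cotangentBracket P α β x + differential f x (P x (α x)) • β x := by
  ext v
  obtain ⟨Y, hY, rfl⟩ := exists_vectorDiffAt_eq v
  change cotangentBracket P α (smulForm f β) x (Y x) =
    f x * cotangentBracket P α β x (Y x) + differential f x (P x (α x)) * β x (Y x)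
  rw [cotangentBracket_apply P _ _ hY, cotangentBracket_apply P _ _ hY]
  exact rawBracket_smul_right hP ((f.contMDiff x).mdifferentiableAt (by simp)) (formDiffAt α x)
    (formDiffAt β x) hY

theorem cotangentBracket_const_smul_right {P : ContravariantTensors E M} (hP : IsSkew P)
    (t : ℝ) (α β : OneForms E M) :
    cotangentBracket P α (t • β) = t • cotangentBracket P α β := by
  ext x : 1
  have h := cotangentBracket_smulForm_right hP (ContMDiffMap.const t) α β x
  have h0 : differential (ContMDiffMap.const t : C^∞⟮𝓘(ℝ, E), M; ℝ⟯) x = 0 :=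
    mvfderiv_const t
  rw [h0, zero_apply, zero_smul, add_zero] at h
  exact h

theorem cotangentBracket_add_left {P : ContravariantTensors E M} (hP : IsSkew P)
    (α β γ : OneForms E M) :
    cotangentBracket P (α + β) γ = cotangentBracket P α γ + cotangentBracket P β γ := by
  rw [cotangentBracket_swap hP, cotangentBracket_add_right, neg_add, ← cotangentBracket_swap hP,
    ← cotangentBracket_swap hP]

theorem cotangentBracket_const_smul_left {P : ContravariantTensors E M} (hP : IsSkew P)
    (t : ℝ) (α β : OneForms E M) :
    cotangentBracket P (t • α) β = t • cotangentBracket P α β := by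
  rw [cotangentBracket_swap hP, cotangentBracket_const_smul_right hP, cotangentBracket_swap hP α]
  ext x : 1
  exact (smul_neg t (cotangentBracket P β α x)).symm

/-! ### Tensoriality of the anchor defect and the morphism property -/

/-- The cotangent and Lie brackets satisfy Leibniz rules with the same derivative `P(σ)f`. Skewness
gives `τ(P(dh)) = -dh(P(τ))`, which explains the plus sign in `anchorDefect` and cancels the two
derivative terms. -/
theorem tensorialAt_anchorDefect {P : ContravariantTensors E M} (hP : IsSkew P)
    (h : C^∞⟮𝓘(ℝ, E), M; ℝ⟯) (x : M) {σ : ∀ y : M, CotangentFiber E y} (hσ : FormDiffAt σ x) :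
    TensorialAt 𝓘(ℝ, E) (E →L[ℝ] ℝ) (fun τ : ∀ y : M, CotangentFiber E y =>
      anchorDefect P h x σ τ) x where
  smul {f τ} hf hτ := by
    have := isManifold_minSmoothness_two (E := E) (M := M)
    have hs : τ x (sharp P (differential h) x) = -differential h x (rawSharp P τ x) :=
      hP x (differential h x) (τ x)
    rw [anchorDefect, anchorDefect, rawBracket_smul_right hP hf hσ hτ
      (sharp P (differential h)).mdifferentiableAt, rawSharp_smul,
      VectorField.mlieBracket_smul_right hf (vectorDiffAt_rawSharp P hτ), map_add, map_smul,
      map_smul, hs]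
    simp only [smul_eq_mul]
    ring
  add {τ τ'} hτ hτ' := by
    have := isManifold_minSmoothness_two (E := E) (M := M)
    simp only [anchorDefect]
    rw [rawBracket_add_right P hσ hτ hτ' (sharp P (differential h)).mdifferentiableAt,
      rawSharp_add, VectorField.mlieBracket_add_right (vectorDiffAt_rawSharp P hτ)
        (vectorDiffAt_rawSharp P hτ'), map_add]
    ring

/-- On exact forms both terms become iterated Poisson brackets, and their sum is the Jacobi
expression. -/
theorem anchorDefect_differential {P : ContravariantTensors E M} (hP : IsPoisson P)
    (f g h : C^∞⟮𝓘(ℝ, E), M; ℝ⟯) (x : M) :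
    anchorDefect P h x (differential f) (differential g) = 0 := by
  have h1 : differential h x (VectorField.mlieBracket 𝓘(ℝ, E) (rawSharp P (differential f))
        (rawSharp P (differential g)) x) =
      poissonBracket P f (poissonBracket P g h) x - poissonBracket P g (poissonBracket P f h) x :=
    mvfderiv_mlieBracket h.contMDiff (vectorDiffAt_rawSharp P (formDiffAt (differential f) x))
      (vectorDiffAt_rawSharp P (formDiffAt (differential g) x))
  have h2 := rawBracket_mvfderiv hP.skew f g (x := x) (sharp P (differential h)).mdifferentiableAt
  have h3 : differential (poissonBracket P f g) x (sharp P (differential h) x) =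
    poissonBracket P h (poissonBracket P f g) x := rfl
  have h4 : poissonBracket P f (poissonBracket P g h) x
      + poissonBracket P g (poissonBracket P h f) x
      + poissonBracket P h (poissonBracket P f g) x = 0 :=
    congrArg (fun k : C^∞⟮𝓘(ℝ, E), M; ℝ⟯ => k x) (hP.jacobi f g h)
  rw [poissonBracket_swap hP.skew h f, poissonBracket_neg_right_apply] at h4
  rw [anchorDefect, h1, h2, h3]
  linarith

theorem anchorDefect_eq_zero [T2Space M] {P : ContravariantTensors E M} (hP : IsPoisson P)
    (h : C^∞⟮𝓘(ℝ, E), M; ℝ⟯) (α β : OneForms E M) (x : M) : anchorDefect P h x α β = 0 := by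
  obtain ⟨f, hf⟩ := exists_differential_eq x (α x)
  obtain ⟨g, hg⟩ := exists_differential_eq x (β x)
  -- Tensoriality is available in the second slot; antisymmetry transfers it to the first, so both
  -- forms can be replaced by exact ones with the same value at `x`.
  rw [(tensorialAt_anchorDefect hP.skew h x (formDiffAt α x)).pointwise (formDiffAt β x)
      (formDiffAt (differential g) x) hg.symm, anchorDefect_swap hP.skew,
    (tensorialAt_anchorDefect hP.skew h x (formDiffAt (differential g) x)).pointwise
      (formDiffAt α x) (formDiffAt (differential f) x) hf.symm, anchorDefect_differential hP,
    neg_zero]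

theorem tangent_eq_of_forall_differential [T2Space M] {x : M} {v w : TangentSpace 𝓘(ℝ, E) x}
    (h : ∀ f : C^∞⟮𝓘(ℝ, E), M; ℝ⟯, differential f x v = differential f x w) : v = w := by
  refine (SeparatingDual.eq_iff_forall_dual_eq (R := ℝ) (V := E)).2 fun a => ?_
  obtain ⟨f, hf⟩ := exists_differential_eq x (a : CotangentFiber E x)
  have := h f
  rw [hf] at this
  exact this

/-- A Poisson tensor maps the bracket of 1-forms to the Lie bracket of vector fields. -/
theorem sharp_cotangentBracket [T2Space M] {P : ContravariantTensors E M} (hP : IsPoisson P)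
    (α β : OneForms E M) (x : M) :
    P x (cotangentBracket P α β x) =
      VectorField.mlieBracket 𝓘(ℝ, E) (sharp P α) (sharp P β) x := by
  refine tangent_eq_of_forall_differential fun h => ?_
  have h1 := anchorDefect_eq_zero hP h α β x
  rw [anchorDefect, ← cotangentBracket_apply P α β (sharp P (differential h)).mdifferentiableAt]
    at h1
  rw [hP.skew]
  exact neg_eq_of_add_eq_zero_right h1

end FiniteDim

end

section

variable {E : Type*} [NormedAddCommGroup E] [NormedSpace ℝ E]
  {M : Type*} [TopologicalSpace M] [ChartedSpace E M] [IsManifold 𝓘(ℝ, E) ∞ M]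

/-! ### Contractions by Saletan tensors -/

theorem applyEnd_smulForm (N : CotangentEndomorphisms E M) (f : C^∞⟮𝓘(ℝ, E), M; ℝ⟯)
    (β : OneForms E M) : applyEnd N (smulForm f β) = smulForm f (applyEnd N β) := by
  ext x : 1
  exact map_smul (N x) (f x) (β x)

/-- Transposing `N` turns `⟨β, PNα⟩` into `⟨Nβ, Pα⟩`, and skewness of `P` finishes. The converse is
`comp_eq_of_isSkew_compEnd`. -/
theorem isSkew_compEnd_of_comp_eq [FiniteDimensional ℝ E] {P : ContravariantTensors E M}
    (hP : IsSkew P) {N : CotangentEndomorphisms E M}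
    (h : ∀ x : M, (P x).comp (N x) = (dualEnd N x).comp (P x)) : IsSkew (compEnd P N) := by
  intro x α β
  calc β ((P x).comp (N x) α) = N x β (P x α) := by
        rw [h x]; exact apply_dualEnd N x β (P x α)
    _ = -α (P x (N x β)) := hP x α (N x β)

theorem comp_eq_of_isSkew_compEnd [FiniteDimensional ℝ E] {P : ContravariantTensors E M}
    (hP : IsSkew P) {N : CotangentEndomorphisms E M} (h : IsSkew (compEnd P N)) (x : M) :
    (P x).comp (N x) = (dualEnd N x).comp (P x) := by
  ext α
  refine (SeparatingDual.eq_iff_forall_dual_eq (R := ℝ) (V := E)).2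
    fun (β : CotangentFiber E x) => ?_
  have h1 : β (P x (N x α)) = -α (P x (N x β)) := h x α β
  have h2 : N x β (P x α) = -α (P x (N x β)) := hP x α (N x β)
  exact (h1.trans h2.symm).trans (apply_dualEnd N x β (P x α)).symm

/-- `τ` takes values in the Riesz component and `N τ` is the Nijenhuis torsion. -/
structure IsTorsionLift (μ : OneForms E M → OneForms E M → OneForms E M)
    (N : CotangentEndomorphisms E M) (τ : OneForms E M → OneForms E M → OneForms E M) : Prop where
  mem : ∀ α β x, τ α β x ∈ rieszComponent N x
  applyEnd_eq : ∀ α β, applyEnd N (τ α β) = torsion μ N α β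

/-- The contraction of `μ` by `N` associated with a lift of the torsion. -/
def liftedProduct (μ : OneForms E M → OneForms E M → OneForms E M)
    (N : CotangentEndomorphisms E M) (τ : OneForms E M → OneForms E M → OneForms E M)
    (α β : OneForms E M) : OneForms E M :=
  deformedProduct μ N α β + τ α β

/-- By definition of the torsion, `Nδ + T` is `μ(Nα, Nβ)`. Thus `N` intertwines the contraction with
`μ`. -/
theorem IsTorsionLift.apply_liftedProduct {μ : OneForms E M → OneForms E M → OneForms E M}
    {N : CotangentEndomorphisms E M} {τ : OneForms E M → OneForms E M → OneForms E M}
    (hτ : IsTorsionLift μ N τ) (α β : OneForms E M) (x : M) :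
    N x (liftedProduct μ N τ α β x) = μ (applyEnd N α) (applyEnd N β) x := by
  have h : N x (τ α β x) = μ (applyEnd N α) (applyEnd N β) x - N x (deformedProduct μ N α β x) :=
    congrArg (fun θ : OneForms E M => θ x) (hτ.applyEnd_eq α β)
  change N x (deformedProduct μ N α β x + τ α β x) = _
  rw [(N x).map_add, h, add_sub_cancel]

section FiniteDim

variable [FiniteDimensional ℝ E]

instance finiteDimensional_cotangentFiber (x : M) : FiniteDimensional ℝ (CotangentFiber E x) :=
  inferInstanceAs (FiniteDimensional ℝ (E →L[ℝ] ℝ))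

/-- The terms `(P(α)f) Nβ` coming from `μ(α, fNβ)` and from `N μ(α, fβ)` cancel, leaving the anchor
`PN`. -/
theorem deformedProduct_smulForm_right {P : ContravariantTensors E M} (hP : IsSkew P)
    (N : CotangentEndomorphisms E M) (f : C^∞⟮𝓘(ℝ, E), M; ℝ⟯) (α β : OneForms E M) (x : M) :
    deformedProduct (cotangentBracket P) N α (smulForm f β) x =
      f x • deformedProduct (cotangentBracket P) N α β x
        + differential f x (P x (N x (α x))) • β x := by
  change cotangentBracket P (applyEnd N α) (smulForm f β) x
      + cotangentBracket P α (applyEnd N (smulForm f β)) x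
      - N x (cotangentBracket P α (smulForm f β) x) =
    f x • (cotangentBracket P (applyEnd N α) β x + cotangentBracket P α (applyEnd N β) x
      - N x (cotangentBracket P α β x)) + _
  rw [applyEnd_smulForm, cotangentBracket_smulForm_right hP, cotangentBracket_smulForm_right hP,
    cotangentBracket_smulForm_right hP, (N x).map_add, (N x).map_smul, (N x).map_smul, smul_sub,
    smul_add]
  change _ + differential f x (P x (N x (α x))) • β x
    + (_ + differential f x (P x (α x)) • N x (β x)) - _ = _
  abel

/-- Both parts of the torsion contribute the same derivative term `(PN(α)f) Nβ`. -/
theorem torsion_smulForm_right {P : ContravariantTensors E M} (hP : IsSkew P)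
    (N : CotangentEndomorphisms E M) (f : C^∞⟮𝓘(ℝ, E), M; ℝ⟯) (α β : OneForms E M) (x : M) :
    torsion (cotangentBracket P) N α (smulForm f β) x =
      f x • torsion (cotangentBracket P) N α β x := by
  change cotangentBracket P (applyEnd N α) (applyEnd N (smulForm f β)) x
      - N x (deformedProduct (cotangentBracket P) N α (smulForm f β) x) =
    f x • (cotangentBracket P (applyEnd N α) (applyEnd N β) x
      - N x (deformedProduct (cotangentBracket P) N α β x))
  rw [applyEnd_smulForm, cotangentBracket_smulForm_right hP, deformedProduct_smulForm_right hP,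
    (N x).map_add, (N x).map_smul, (N x).map_smul, smul_sub]
  change _ + differential f x (P x (N x (α x))) • N x (β x) - _ = _
  abel

/-- `N` is injective on the Riesz component, so the lift inherits the function-linearity of the
torsion. -/
theorem IsTorsionLift.smulForm_right {P : ContravariantTensors E M} (hP : IsSkew P)
    {N : CotangentEndomorphisms E M} {τ : OneForms E M → OneForms E M → OneForms E M}
    (hτ : IsTorsionLift (cotangentBracket P) N τ) (f : C^∞⟮𝓘(ℝ, E), M; ℝ⟯)
    (α β : OneForms E M) (x : M) : τ α (smulForm f β) x = f x • τ α β x := by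
  have hN (γ : OneForms E M) : N x (τ α γ x) = torsion (cotangentBracket P) N α γ x :=
    congrArg (fun θ : OneForms E M => θ x) (hτ.applyEnd_eq α γ)
  refine sub_eq_zero.1 (eq_zero_of_mem_range_pow_finrank
    (A := (N x : Module.End ℝ (CotangentFiber E x)))
    (Submodule.sub_mem _ (hτ.mem α _ x) (Submodule.smul_mem _ (f x) (hτ.mem α β x))) ?_)
  change N x (τ α (smulForm f β) x - f x • τ α β x) = 0
  rw [(N x).map_sub, (N x).map_smul, hN, hN, torsion_smulForm_right hP, sub_self]

theorem liftedProduct_smulForm_right {P : ContravariantTensors E M} (hP : IsSkew P)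
    {N : CotangentEndomorphisms E M} {τ : OneForms E M → OneForms E M → OneForms E M}
    (hτ : IsTorsionLift (cotangentBracket P) N τ) (f : C^∞⟮𝓘(ℝ, E), M; ℝ⟯)
    (α β : OneForms E M) (x : M) :
    liftedProduct (cotangentBracket P) N τ α (smulForm f β) x =
      f x • liftedProduct (cotangentBracket P) N τ α β x
        + differential f x (P x (N x (α x))) • β x := by
  change deformedProduct (cotangentBracket P) N α (smulForm f β) x + τ α (smulForm f β) x =
    f x • (deformedProduct (cotangentBracket P) N α β x + τ α β x) + _
  rw [deformedProduct_smulForm_right hP, hτ.smulForm_right hP, smul_add]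
  abel

theorem isContraction_liftedProduct {P : ContravariantTensors E M} (hP : IsSkew P)
    {N : CotangentEndomorphisms E M} {τ : OneForms E M → OneForms E M → OneForms E M}
    (hτ : IsTorsionLift (cotangentBracket P) N τ) :
    IsContraction (cotangentBracket P) N (liftedProduct (cotangentBracket P) N τ) := by
  intro α β x
  have hlim : Tendsto (fun t : ℝ =>
      (t • cotangentBracket P α β x + deformedProduct (cotangentBracket P) N α β x)
        + (t • ContinuousLinearMap.id ℝ (CotangentFiber E x) + N x).inverse (N x (τ α β x)))
      (𝓝[≠] 0) (𝓝 (liftedProduct (cotangentBracket P) N τ α β x)) := by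
    refine Tendsto.add ?_ (tendsto_inverse_smul_id_add_apply (N x) (hτ.mem α β x))
    have hc : Continuous fun t : ℝ =>
        t • cotangentBracket P α β x + deformedProduct (cotangentBracket P) N α β x :=
      (continuous_id.smul continuous_const).add continuous_const
    have h := hc.tendsto 0
    rw [zero_smul, zero_add] at h
    exact h.mono_left nhdsWithin_le_nhds
  refine hlim.congr' ?_
  filter_upwards [eventually_isInvertible_smul_id_add (N x)] with t ht
  -- Bilinearity of the bracket, with `μ(Nα, Nβ)` rewritten as `Nδ + Nτ`.
  have hexp : cotangentBracket P (t • α + applyEnd N α) (t • β + applyEnd N β) x =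
      (t • ContinuousLinearMap.id ℝ (CotangentFiber E x) + N x)
        (t • cotangentBracket P α β x + deformedProduct (cotangentBracket P) N α β x)
        + N x (τ α β x) := by
    have h := hτ.apply_liftedProduct α β x
    change N x (deformedProduct (cotangentBracket P) N α β x + τ α β x) = _ at h
    rw [(N x).map_add] at h
    rw [cotangentBracket_add_left hP, cotangentBracket_add_right, cotangentBracket_add_right,
      cotangentBracket_const_smul_left hP, cotangentBracket_const_smul_left hP,
      cotangentBracket_const_smul_right hP, cotangentBracket_const_smul_right hP]
    change (t • t • cotangentBracket P α β x + t • cotangentBracket P α (applyEnd N β) x)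
        + (t • cotangentBracket P (applyEnd N α) β x
          + cotangentBracket P (applyEnd N α) (applyEnd N β) x) =
      t • (t • cotangentBracket P α β x + (cotangentBracket P (applyEnd N α) β x
          + cotangentBracket P α (applyEnd N β) x - N x (cotangentBracket P α β x)))
        + N x (t • cotangentBracket P α β x + deformedProduct (cotangentBracket P) N α β x)
        + N x (τ α β x)
    rw [← h, (N x).map_add (t • _), (N x).map_smul, smul_add, smul_sub, smul_add]
    abel
  rw [hexp, ContinuousLinearMap.map_add, ht.inverse_apply_self]

/-! ### Recovering the tensor from the product, and the Jacobi identity from the anchor -/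

/-- The Leibniz rule determines the anchor: equal products differentiate functions along the same
vector field. -/
theorem eq_compEnd_of_liftedProduct_eq [T2Space M] {P : ContravariantTensors E M} (hP : IsSkew P)
    {N : CotangentEndomorphisms E M} {τ : OneForms E M → OneForms E M → OneForms E M}
    (hτ : IsTorsionLift (cotangentBracket P) N τ) {Q : ContravariantTensors E M} (hQ : IsSkew Q)
    (h : liftedProduct (cotangentBracket P) N τ = cotangentBracket Q) : Q = compEnd P N := by
  ext x a : 2
  obtain ⟨k, rfl⟩ := exists_differential_eq x a
  refine tangent_eq_of_forall_differential fun f => ?_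
  -- Taking `β = df` with the same `f` means that no auxiliary nonvanishing form is needed.
  have h1 := liftedProduct_smulForm_right hP hτ f (differential k) (differential f) x
  rw [h, cotangentBracket_smulForm_right hQ] at h1
  have h2 := add_left_cancel h1
  have h3 := congrArg (fun a : CotangentFiber E x => a (Q x (differential k x))) h2
  have h4 := congrArg (fun a : CotangentFiber E x => a (P x (N x (differential k x)))) h2
  simp only [smul_apply, smul_eq_mul] at h3 h4
  change _ = differential f x (P x (N x (differential k x)))
  -- With `a = df(Q dk)` and `b = df(PN dk)`, the two evaluations read `a² = ba` and `ab = b²`, so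
  -- `(a - b)² = 0`.
  nlinarith [sq_nonneg (differential f x (Q x (differential k x))
    - differential f x (P x (N x (differential k x))))]

/-- A skew tensor whose anchor is a morphism of brackets is a Poisson tensor. -/
theorem isPoisson_of_sharp_cotangentBracket {P : ContravariantTensors E M} (hP : IsSkew P)
    (h : ∀ (α β : OneForms E M) (x : M), P x (cotangentBracket P α β x) =
      VectorField.mlieBracket 𝓘(ℝ, E) (sharp P α) (sharp P β) x) : IsPoisson P where
  skew := hP
  jacobi f g k := by
    ext x
    have h1 := h (differential f) (differential g) x
    rw [cotangentBracket_differential hP] at h1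
    have h2 : differential k x (VectorField.mlieBracket 𝓘(ℝ, E) (sharp P (differential f))
          (sharp P (differential g)) x) =
        poissonBracket P f (poissonBracket P g k) x
          - poissonBracket P g (poissonBracket P f k) x :=
      mvfderiv_mlieBracket k.contMDiff (sharp P (differential f)).mdifferentiableAt
        (sharp P (differential g)).mdifferentiableAt
    have h3 : differential k x (P x (differential (poissonBracket P f g) x)) =
      poissonBracket P (poissonBracket P f g) k x := rfl
    have h4 : poissonBracket P (poissonBracket P f g) k x =
        -poissonBracket P k (poissonBracket P f g) x :=
      hP x (differential (poissonBracket P f g) x) (differential k x)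
    rw [← h1, h3, h4] at h2
    change poissonBracket P f (poissonBracket P g k) x + poissonBracket P g (poissonBracket P k f) x
      + poissonBracket P k (poissonBracket P f g) x = 0
    rw [poissonBracket_swap hP k f, poissonBracket_neg_right_apply]
    linarith

end FiniteDim

end

end PoissonContraction

end

theorem theorem14 {E : Type*} [NormedAddCommGroup E] [NormedSpace ℝ E] [FiniteDimensional ℝ E]
    {M : Type*} [TopologicalSpace M] [T2Space M] [ChartedSpace E M] [IsManifold 𝓘(ℝ, E) ∞ M]
    (P : ContravariantTensors E M) (hP : IsPoisson P)
    (N : CotangentEndomorphisms E M) (hN : IsSaletan (cotangentBracket P) N) :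
    ∃ ν : OneForms E M → OneForms E M → OneForms E M,
      IsContraction (cotangentBracket P) N ν ∧
      ((∃ P₁ : ContravariantTensors E M, IsPoisson P₁ ∧ ν = cotangentBracket P₁) ↔
        (∀ x : M, (P x).comp (N x) = (dualEnd N x).comp (P x)) ∧
          ν = cotangentBracket (compEnd P N)) ∧
      (∀ P₁ : ContravariantTensors E M,
        IsPoisson P₁ → ν = cotangentBracket P₁ → P₁ = compEnd P N) := by
  -- Arbitrary choices are harmless: injectivity of `N` on the Riesz component makes the lift
  -- unique.
  choose τ hmem hNτ using hN
  have hτ : IsTorsionLift (cotangentBracket P) N τ := ⟨hmem, hNτ⟩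
  have huniq : ∀ Q : ContravariantTensors E M, IsPoisson Q →
      liftedProduct (cotangentBracket P) N τ = cotangentBracket Q → Q = compEnd P N :=
    fun Q hQ h => eq_compEnd_of_liftedProduct_eq hP.skew hτ hQ.skew h
  refine ⟨liftedProduct (cotangentBracket P) N τ, isContraction_liftedProduct hP.skew hτ,
    ⟨?_, ?_⟩, huniq⟩
  · rintro ⟨Q, hQ, h⟩
    obtain rfl := huniq Q hQ h
    exact ⟨comp_eq_of_isSkew_compEnd hP.skew hQ.skew, h⟩
  · rintro ⟨hcomm, h⟩
    refine ⟨compEnd P N, isPoisson_of_sharp_cotangentBracket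
      (isSkew_compEnd_of_comp_eq hP.skew hcomm) fun α β x => ?_, h⟩
    -- Back in terms of `ν`, applying `PN` gives `P μ(Nα, Nβ)`, to which the morphism property of
    -- `P` applies.
    rw [← h]
    exact (congrArg (P x) (hτ.apply_liftedProduct α β x)).trans
      (sharp_cotangentBracket hP (applyEnd N α) (applyEnd N β) x)
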